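/- For $p\in\mathbb{C}[z_1,z_2]$ of bidegree $(n,m)$ let $\tilde p(z)=z_1^n z_2^m\,\overline{p(1/\bar z_1,1/\bar z_2)}$ be its reflection, and call $p$ semi-stable if $p$ has no zeros in $\mathbb{D}^2$ and $p,\tilde p$ have no common factor. For $\lambda\in\mathbb{C}^2$ let $\mathcal{O}_\lambda$ be the ring of rational functions whose denominators do not vanish at $\lambda$, and let $N_\lambda(p,q)=\dim_{\mathbb{C}}\mathcal{O}_\lambda/\langle p,q\rangle\mathcal{O}_\lambda$ be the intersection multiplicity at $\lambda$. For $c>1$ let $AR_c$ be the set of $\zeta\in\mathbb{C}^2$ with $\operatorname{Re}\zeta_1,\operatorname{Re}\zeta_2>0$ such that $1/c\le x/y\le c$ for all $x,y\in\{|\zeta_1|,|\zeta_2|,\operatorname{Re}\zeta_1,\operatorname{Re}\zeta_2\}$. A function $f$ on $\mathbb{D}^2$ is non-tangentially $C^k$ ($k\ge 0$) at $\lambda\in\mathbb{T}^2$ if there is a polynomial $L$ of total degree at most $k$ such that for every $c>1$ \[ f(\lambda_1(1-\zeta_1),\lambda_2(1-\zeta_2))-L(\zeta)=o(|\zeta_1|^k)\qquad\text{as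 }\zeta\to 0\text{ in }AR_c. \] Theorem. Let $p\in\mathbb{C}[z_1,z_2]$ be semi-stable, let $\lambda\in\mathbb{T}^2$, and let $M\ge 0$ be the order of vanishing of $p$ at $\lambda$, i.e. the degree of the lowest non-zero term of the homogeneous expansion of $p$ at $\lambda$. Then \[ N_\lambda(p,\tilde p)\ge M(M+1), \] and, for every integer $k\ge 0$, if $\tilde p/p$ is non-tangentially $C^k$ at $\lambda$, then \[ N_\lambda(p,\tilde p)\ge M(M+k+1). \] -/

import Mathlib

open Filter Topology Asymptotics

noncomputable section

namespace Bidisk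

/-- Complex polynomials in the two variables `z 0`, `z 1`. -/
abbrev Poly : Type := MvPolynomial (Fin 2) ℂ

/-- The bidegree of `p`, as an exponent vector. -/
def bidegree (p : Poly) : Fin 2 →₀ ℕ :=
  Finsupp.equivFunOnFinite.symm fun i => p.degreeOf i

/-- The reflection `z₁ ^ n * z₂ ^ m * conj (p (1 / conj z₁, 1 / conj z₂))` of a polynomial `p` of
bidegree `(n, m)`, as a polynomial: the coefficient of `z ^ e` in `p` is conjugated and moved to
`z ^ ((n, m) - e)`. See `eval_reflection`. -/
def reflection (p : Poly) : Poly :=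
  ∑ e ∈ p.support, MvPolynomial.monomial (bidegree p - e) (starRingEnd ℂ (p.coeff e))

/-- `reflection` is given by the usual formula off the coordinate axes. -/
theorem eval_reflection (p : Poly) (z : Fin 2 → ℂ) (hz : ∀ i, z i ≠ 0) :
    MvPolynomial.eval z (reflection p) =
      z 0 ^ p.degreeOf 0 * z 1 ^ p.degreeOf 1 *
        starRingEnd ℂ (MvPolynomial.eval (fun i => 1 / starRingEnd ℂ (z i)) p) := by
  rw [reflection, map_sum, MvPolynomial.eval_eq', map_sum, Finset.mul_sum]
  refine Finset.sum_congr rfl fun e he => ?_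
  have h0 : e 0 ≤ p.degreeOf 0 := MvPolynomial.monomial_le_degreeOf 0 he
  have h1 : e 1 ≤ p.degreeOf 1 := MvPolynomial.monomial_le_degreeOf 1 he
  rw [MvPolynomial.eval_monomial, Finsupp.prod_fintype _ _ (by simp)]
  simp only [Fin.prod_univ_two, bidegree, Finsupp.coe_tsub, Pi.sub_apply,
    Finsupp.equivFunOnFinite_symm_apply_apply, map_mul, map_pow, map_div₀, map_one,
    Complex.conj_conj]
  rw [pow_sub₀ _ (hz 0) h0, pow_sub₀ _ (hz 1) h1]
  simp only [one_div, inv_pow]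
  ring

/-- `p` has no zeros in the open bidisk and no common factor with its reflection. -/
structure SemiStable (p : Poly) : Prop where
  ne_zero_of_mem_bidisk : ∀ z : Fin 2 → ℂ, (∀ i, ‖z i‖ < 1) → MvPolynomial.eval z p ≠ 0
  no_common_factor : IsRelPrime p (reflection p)

/-- The polynomial `p (a + X)`. -/
def translateTo (a : Fin 2 → ℂ) (p : Poly) : Poly :=
  MvPolynomial.bind₁ (fun i => MvPolynomial.C (a i) + MvPolynomial.X i) p

/-- `p` vanishes to order exactly `M` at `a`: the lowest non-zero term of the homogeneous
expansion of `p` at `a` has degree `M`. -/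
def VanishesToOrder (p : Poly) (a : Fin 2 → ℂ) (M : ℕ) : Prop :=
  (∀ j < M, MvPolynomial.homogeneousComponent j (translateTo a p) = 0) ∧
    MvPolynomial.homogeneousComponent M (translateTo a p) ≠ 0

/-- The (maximal) ideal of polynomials that vanish at `a`. -/
abbrev pointIdeal (a : Fin 2 → ℂ) : Ideal Poly := RingHom.ker (MvPolynomial.eval a)

instance pointIdeal_isPrime (a : Fin 2 → ℂ) : (pointIdeal a).IsPrime :=
  RingHom.ker_isPrime _

/-- The local ring at `a`: rational functions whose denominators do not vanish at `a`. -/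
abbrev LocalRingAt (a : Fin 2 → ℂ) : Type := Localization.AtPrime (pointIdeal a)

/-- The intersection multiplicity of `p` and `q` at `a`: the dimension over `ℂ` of the quotient of
the local ring at `a` by the ideal generated by `p` and `q`. -/
def intersectionMultiplicity (a : Fin 2 → ℂ) (p q : Poly) : ℕ :=
  Module.finrank ℂ
    (LocalRingAt a ⧸ (Ideal.span {p, q}).map (algebraMap Poly (LocalRingAt a)))

/-- The four quantities that are comparable in a non-tangential approach region. -/
def comparables (ζ : Fin 2 → ℂ) : Set ℝ := {‖ζ 0‖, ‖ζ 1‖, (ζ 0).re, (ζ 1).re}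

/-- The non-tangential approach region to `0` in the product of two right half-planes, with
aperture `c`. -/
def approachRegion (c : ℝ) : Set (Fin 2 → ℂ) :=
  {ζ | (∀ i, 0 < (ζ i).re) ∧
    ∀ x ∈ comparables ζ, ∀ y ∈ comparables ζ, 1 / c ≤ x / y ∧ x / y ≤ c}

/-- `f` is non-tangentially `C^k` at the point `a` of the two-torus: there is a polynomial `L` of
total degree at most `k` such that `f (a₁ (1 - ζ₁), a₂ (1 - ζ₂)) - L ζ = o(|ζ₁| ^ k)` as `ζ → 0`
in any approach region. The rotation by `a` carries the point `(1, 1)` to `a`. -/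
def NontangentiallyC (k : ℕ) (f : (Fin 2 → ℂ) → ℂ) (a : Fin 2 → ℂ) : Prop :=
  ∃ L : Poly, L.totalDegree ≤ k ∧ ∀ c : ℝ, 1 < c →
    (fun ζ : Fin 2 → ℂ => f (fun i => a i * (1 - ζ i)) - MvPolynomial.eval ζ L)
      =o[𝓝[approachRegion c] 0] fun ζ => ‖ζ 0‖ ^ k

end Bidisk

end

/-! Intersection multiplicity depends only on the ideal and is at least the product of the orders of
vanishing of two generators. So `reflection p` may be replaced by `reflection p - L * p` for any
polynomial `L`, and everything rests on finding `L` that makes this difference vanish to high order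
`K`; then the multiplicity is at least `M * K`.

If the quotient is non-tangentially `C^k` with Taylor polynomial `L`, multiplying by `p = O(s ^ M)`
gives a difference `o(s ^ (M + k))` along real rays, and a polynomial this small on infinitely many
rays has order at least `M + k + 1` (`homogeneousComponent_eq_zero_of_rays`).

Without that hypothesis a constant `L` gains one order. By Hurwitz's theorem the lowest form of `p`
has only real roots in the ratio `ζ₂ / ζ₁`, because every non-real ratio is attained in the product
of right half-planes, where `p` has no zeros (`im_eq_zero_of_eval_bottom`). Hence conjugation
multiplies this form by a constant on real rays, and the lowest form of the reflection is
proportional to that of `p`.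

The product bound (`mul_le_intersectionMultiplicity`) is a dimension count in a truncated polynomial
ring. It needs the local quotient to be finite-dimensional, since `finrank` is `0` otherwise;
coprimality provides this. -/

/-! ### Finite-dimensionality of the quotient by a coprime pair. -/

namespace Polynomial

/-- Two relatively prime polynomials over a factorial domain become coprime over the fraction
field; after clearing denominators they generate an ideal with a nonzero constant. -/
theorem exists_C_mem_span_of_isRelPrime {R : Type*} [CommRing R] [IsDomain R]
    [UniqueFactorizationMonoid R] {f g : R[X]} (h : IsRelPrime f g) :
    ∃ r : R, r ≠ 0 ∧ C r ∈ Ideal.span {f, g} := by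
  classical
  let _ : NormalizedGCDMonoid R := Classical.arbitrary _
  let K := FractionRing R
  have hinj : Function.Injective (Polynomial.map (algebraMap R K)) :=
    map_injective _ (IsFractionRing.injective _ _)
  have hfg : f ≠ 0 ∨ g ≠ 0 := by
    by_contra! hc
    rw [hc.1, hc.2] at h
    exact not_isUnit_zero (h dvd_rfl dvd_rfl)
  have hcop : IsCoprime (f.map (algebraMap R K)) (g.map (algebraMap R K)) := by
    rw [← EuclideanDomain.gcd_isUnit_iff]
    set d := EuclideanDomain.gcd (f.map (algebraMap R K)) (g.map (algebraMap R K)) with hd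
    have hd0 : d ≠ 0 := by
      intro h0
      rw [hd, EuclideanDomain.gcd_eq_zero_iff] at h0
      rcases hfg with h1 | h1
      · exact h1 (hinj (by simpa using h0.1))
      · exact h1 (hinj (by simpa using h0.2))
    -- After clearing denominators in the gcd `d`, Gauss's lemma makes its primitive part a common
    -- divisor over `R`, hence a unit.
    obtain ⟨c, c0, hc⟩ := IsLocalization.integerNormalization_spec (nonZeroDivisors R) d
    set D := IsLocalization.integerNormalization (nonZeroDivisors R) d with hD
    have key : ∀ {k : R[X]}, d ∣ k.map (algebraMap R K) → D.primPart ∣ k := by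
      intro k hk
      refine (isPrimitive_primPart D).dvd_of_fraction_map_dvd_fraction_map (K := K) ?_
      have h1 : D.primPart.map (algebraMap R K) ∣ C (algebraMap R K c) * d := by
        have : D.map (algebraMap R K) = C (algebraMap R K c) * d := by
          rw [hc, Algebra.smul_def, algebraMap_apply]
        rw [← this]
        exact Polynomial.map_dvd _ (primPart_dvd D)
      have hu : IsUnit (C (algebraMap R K c)) := by
        rw [isUnit_C, isUnit_iff_ne_zero]
        exact IsLocalization.to_map_ne_zero_of_mem_nonZeroDivisors K le_rfl c0
      exact (hu.dvd_mul_left.1 h1).trans hk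
    exact isUnit_or_eq_zero_of_isUnit_integerNormalization_primPart hd0
      (h (key (EuclideanDomain.gcd_dvd_left _ _)) (key (EuclideanDomain.gcd_dvd_right _ _)))
  obtain ⟨u, v, huv⟩ := hcop
  obtain ⟨b, b0, hb⟩ := IsLocalization.integerNormalization_spec (nonZeroDivisors R) u
  obtain ⟨c, c0, hc⟩ := IsLocalization.integerNormalization_spec (nonZeroDivisors R) v
  rw [Algebra.smul_def, algebraMap_apply] at hb hc
  refine ⟨b * c, nonZeroDivisors.ne_zero (mul_mem b0 c0), Ideal.mem_span_pair.2
    ⟨C c * IsLocalization.integerNormalization (nonZeroDivisors R) u,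
      C b * IsLocalization.integerNormalization (nonZeroDivisors R) v, hinj ?_⟩⟩
  simp only [Polynomial.map_add, Polynomial.map_mul, hb, hc, map_C, map_mul]
  linear_combination (C ((algebraMap R K) b) * C ((algebraMap R K) c)) * huv

end Polynomial

namespace Bidisk

open MvPolynomial

theorem finSuccEquiv_rename_succ {R : Type*} [CommRing R] {n : ℕ} (r : MvPolynomial (Fin n) R) :
    finSuccEquiv R n (rename Fin.succ r) = Polynomial.C r := by
  induction r using MvPolynomial.induction_on with
  | C c => simp [finSuccEquiv_apply]
  | add f g hf hg => simp [hf, hg]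
  | mul_X f i hf => simp only [map_mul, rename_X, hf, finSuccEquiv_X_succ]

/-- Elimination of `X 0`: viewed as polynomials in `X 0` over `ℂ[X 1]`, the coprime pair generates a
nonzero polynomial in `X 1` alone, and `φ` kills it. -/
theorem isIntegral_map_X_one {B : Type*} [CommRing B] [Algebra ℂ B] {p q : Poly}
    (h : IsRelPrime p q) (φ : Poly →ₐ[ℂ] B) (hp : φ p = 0) (hq : φ q = 0) :
    IsIntegral ℂ (φ (X 1)) := by
  have h' : IsRelPrime (finSuccEquiv ℂ 1 p) (finSuccEquiv ℂ 1 q) := by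
    refine IsRelPrime.of_map (finSuccEquiv ℂ 1).symm ?_
    simpa using h
  obtain ⟨r, r0, hr⟩ := Polynomial.exists_C_mem_span_of_isRelPrime h'
  have hr' : φ (rename Fin.succ r) = 0 := by
    obtain ⟨u, v, huv⟩ := Ideal.mem_span_pair.1 hr
    have : rename Fin.succ r
        = (finSuccEquiv ℂ 1).symm u * p + (finSuccEquiv ℂ 1).symm v * q := by
      apply (finSuccEquiv ℂ 1).injective
      simp [finSuccEquiv_rename_succ, huv]
    rw [this]
    simp [hp, hq]
  rw [← isAlgebraic_iff_isIntegral]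
  by_contra ht
  have hx : AlgebraicIndependent ℂ fun _ : Fin 1 => φ (X 1) :=
    algebraicIndependent_unique_type_iff.2 ht
  refine r0 (hx ?_)
  rw [map_zero, ← hr', ← AlgHom.comp_apply]
  congr 1
  ext i
  fin_cases i
  simp

theorem isIntegral_map_X {B : Type*} [CommRing B] [Algebra ℂ B] {p q : Poly}
    (h : IsRelPrime p q) (φ : Poly →ₐ[ℂ] B) (hp : φ p = 0) (hq : φ q = 0) (i : Fin 2) :
    IsIntegral ℂ (φ (X i)) := by
  let e : Poly ≃ₐ[ℂ] Poly := renameEquiv ℂ (Equiv.swap i 1)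
  have h' : IsRelPrime (e.symm p) (e.symm q) := by
    refine IsRelPrime.of_map e ?_
    simpa using h
  simpa [e] using isIntegral_map_X_one h' (φ.comp e.toAlgHom) (by simp [hp]) (by simp [hq])

theorem finite_quotient_span {p q : Poly} (h : IsRelPrime p q) :
    Module.Finite ℂ (Poly ⧸ Ideal.span {p, q}) := by
  set φ := Ideal.Quotient.mkₐ ℂ (Ideal.span {p, q}) with hφ
  have hmem : ∀ f ∈ Ideal.span {p, q}, φ f = 0 := fun f hf => Ideal.Quotient.eq_zero_iff_mem.2 hf
  have hfin := Algebra.finite_adjoin_of_finite_of_isIntegral (R := ℂ)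
    (Set.finite_range fun i => φ (X i)) (by
      rintro _ ⟨i, rfl⟩
      exact isIntegral_map_X h φ (hmem _ (Ideal.subset_span (by simp)))
        (hmem _ (Ideal.subset_span (by simp))) i)
  have htop : Algebra.adjoin ℂ (Set.range fun i => φ (X i)) = ⊤ := by
    have := congrArg (Subalgebra.map φ) (adjoin_range_X (R := ℂ) (σ := Fin 2))
    rw [AlgHom.map_adjoin, Algebra.map_top, ← Set.range_comp] at this
    rw [(AlgHom.range_eq_top _).2 (Ideal.Quotient.mkₐ_surjective ℂ _)] at this
    exact this
  rw [htop] at hfin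
  exact Module.Finite.equiv
    (Subalgebra.topEquiv (R := ℂ) (A := Poly ⧸ Ideal.span {p, q})).toLinearEquiv

/-- The global quotient already surjects onto the local one: it is Artinian, so a denominator `s`
satisfies `s ^ (n + 1) * b = s ^ n`, and `b` becomes the inverse of `s` where `s` is a unit. -/
theorem finite_localRingAt_quotient (a : Fin 2 → ℂ) {p q : Poly} (h : IsRelPrime p q) :
    Module.Finite ℂ
      (LocalRingAt a ⧸ (Ideal.span {p, q}).map (algebraMap Poly (LocalRingAt a))) := by
  have := finite_quotient_span h
  have : IsArtinianRing (Poly ⧸ Ideal.span {p, q}) := IsArtinianRing.of_finite ℂ _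
  set I := Ideal.span {p, q} with hI
  set J := I.map (algebraMap Poly (LocalRingAt a)) with hJ
  let φ : Poly →ₐ[ℂ] LocalRingAt a ⧸ J :=
    (Ideal.Quotient.mkₐ ℂ J).comp (IsScalarTower.toAlgHom ℂ Poly (LocalRingAt a))
  let ψ : (Poly ⧸ I) →ₐ[ℂ] LocalRingAt a ⧸ J := Ideal.Quotient.liftₐ I φ fun f hf =>
    Ideal.Quotient.eq_zero_iff_mem.2 (Ideal.mem_map_of_mem _ hf)
  have hψ : ∀ f, ψ (Ideal.Quotient.mk I f) = Ideal.Quotient.mk J (algebraMap _ _ f) := fun _ => rfl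
  refine Module.Finite.of_surjective ψ.toLinearMap fun x => ?_
  obtain ⟨y, rfl⟩ := Ideal.Quotient.mk_surjective x
  obtain ⟨r, s, rfl⟩ := IsLocalization.exists_mk'_eq (pointIdeal a).primeCompl y
  obtain ⟨n, b, hb⟩ := IsArtinian.exists_pow_succ_smul_dvd (Ideal.Quotient.mk I (s : Poly))
    (1 : Poly ⧸ I)
  have hs : IsUnit (ψ (Ideal.Quotient.mk I (s : Poly))) := by
    rw [hψ]
    exact (IsLocalization.map_units (LocalRingAt a) s).map _
  have hb' : ψ (Ideal.Quotient.mk I (s : Poly)) * ψ b = 1 := by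
    have := congrArg ψ hb
    simp only [smul_eq_mul, mul_one, map_mul, map_pow, pow_succ, mul_assoc] at this
    exact (hs.pow n).mul_left_cancel (by rw [this, mul_one])
  refine ⟨Ideal.Quotient.mk I r * b, hs.mul_left_cancel ?_⟩
  have h1 : ψ (Ideal.Quotient.mk I (s : Poly)) * Ideal.Quotient.mk J
      (IsLocalization.mk' (LocalRingAt a) r s) = ψ (Ideal.Quotient.mk I r) := by
    rw [hψ, hψ, ← map_mul, IsLocalization.mk'_spec']
  rw [h1]
  simp only [AlgHom.toLinearMap_apply, map_mul]
  linear_combination ψ (Ideal.Quotient.mk I r) * hb'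

end Bidisk

/-! ### The multiplicity is at least the product of the orders. -/

namespace Bidisk

open MvPolynomial

/-- Exponent vectors in two variables of total degree below `n` form a triangle. -/
noncomputable def degreeLTEquiv (n : ℕ) :
    {e : Fin 2 →₀ ℕ // e.degree < n} ≃ Σ j : Fin n, Fin (j + 1) where
  toFun e := ⟨⟨e.1.degree, e.2⟩, ⟨e.1 0, by
    simp [Finsupp.degree_eq_sum, Fin.sum_univ_two]⟩⟩
  invFun x := ⟨Finsupp.equivFunOnFinite.symm ![(x.2 : ℕ), x.1 - x.2], by
    have := x.2.2
    have := x.1.2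
    simp [Finsupp.degree_eq_sum, Fin.sum_univ_two]
    omega⟩
  left_inv e := by
    ext i
    fin_cases i <;> simp [Finsupp.degree_eq_sum, Fin.sum_univ_two]
  right_inv x := by
    obtain ⟨⟨j, hj⟩, ⟨i, hi⟩⟩ := x
    have hi' : i < j + 1 := hi
    have h : Finsupp.degree (Finsupp.equivFunOnFinite.symm ![i, j - i] : Fin 2 →₀ ℕ) = j := by
      rw [Finsupp.degree_eq_sum, Fin.sum_univ_two]
      change i + (j - i) = j
      omega
    refine Sigma.ext (Fin.ext h) ?_
    rw [Fin.heq_ext_iff]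
    · rfl
    · exact congrArg (· + 1) h

noncomputable instance (n : ℕ) : Fintype {e : Fin 2 →₀ ℕ // e.degree < n} :=
  Fintype.ofEquiv _ (degreeLTEquiv n).symm

theorem two_mul_card_degree_lt (n : ℕ) :
    2 * Fintype.card {e : Fin 2 →₀ ℕ // e.degree < n} = n * (n + 1) := by
  rw [Fintype.card_congr (degreeLTEquiv n), Fintype.card_sigma]
  simp only [Fintype.card_fin]
  rw [Fin.sum_univ_eq_sum_range (fun j => j + 1) n]
  induction n with
  | zero => simp
  | succ n ih => rw [Finset.sum_range_succ, mul_add, ih]; ring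

/-- The coefficients in degrees below `n`. -/
noncomputable def truncate (n : ℕ) : Poly →ₗ[ℂ] ({e : Fin 2 →₀ ℕ // e.degree < n} → ℂ) :=
  LinearMap.pi fun e => lcoeff ℂ e.1

theorem truncate_surjective (n : ℕ) : Function.Surjective (truncate n) := by
  intro c
  refine ⟨∑ e, monomial e.1 (c e), ?_⟩
  ext e
  simp [truncate, coeff_monomial, Subtype.coe_inj]

theorem ker_truncate (n : ℕ) :
    LinearMap.ker (truncate n) = (idealOfVars (Fin 2) ℂ ^ n).restrictScalars ℂ := by
  ext f
  rw [LinearMap.mem_ker, Submodule.restrictScalars_mem, mem_pow_idealOfVars_iff', funext_iff]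
  simp [truncate]

/-- Polynomials modulo terms of degree at least `n`. -/
noncomputable def quotientPowEquiv (n : ℕ) :
    (Poly ⧸ idealOfVars (Fin 2) ℂ ^ n) ≃ₗ[ℂ] ({e : Fin 2 →₀ ℕ // e.degree < n} → ℂ) :=
  (Submodule.Quotient.restrictScalarsEquiv ℂ (idealOfVars (Fin 2) ℂ ^ n)).symm ≪≫ₗ
    Submodule.quotEquivOfEq _ _ (ker_truncate n).symm ≪≫ₗ
    (truncate n).quotKerEquivOfSurjective (truncate_surjective n)

instance (n : ℕ) : Module.Finite ℂ (Poly ⧸ idealOfVars (Fin 2) ℂ ^ n) :=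
  Module.Finite.equiv (quotientPowEquiv n).symm

theorem two_mul_finrank_quotient_pow (n : ℕ) :
    2 * Module.finrank ℂ (Poly ⧸ idealOfVars (Fin 2) ℂ ^ n) = n * (n + 1) := by
  rw [(quotientPowEquiv n).finrank_eq, Module.finrank_pi, two_mul_card_degree_lt]

/-- Multiplication by `f` as a map between truncations. -/
noncomputable def mulTruncated {m : ℕ} {f : Poly} (hf : f ∈ idealOfVars (Fin 2) ℂ ^ m) {k n : ℕ}
    (h : n = m + k) :
    (Poly ⧸ idealOfVars (Fin 2) ℂ ^ k) →ₗ[ℂ] Poly ⧸ idealOfVars (Fin 2) ℂ ^ n :=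
  (Submodule.mapQ (idealOfVars (Fin 2) ℂ ^ k) (idealOfVars (Fin 2) ℂ ^ n)
    (LinearMap.mulLeft Poly f) fun g hg => by
      subst h
      rw [Submodule.mem_comap, LinearMap.mulLeft_apply, pow_add]
      exact Ideal.mul_mem_mul hf hg).restrictScalars ℂ

/-- Modulo terms of degree `M + K`, the multiples of `P` depend only on the cofactor modulo degree
`K`, those of `Q` only modulo degree `M`. With triangular numbers `T n = n * (n + 1) / 2`, what
remains is at least `T (M + K) - T K - T M = M * K`. -/
theorem mul_le_finrank_quotient {M K : ℕ} {P Q : Poly} (hP : P ∈ idealOfVars (Fin 2) ℂ ^ M)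
    (hQ : Q ∈ idealOfVars (Fin 2) ℂ ^ K) :
    M * K ≤ Module.finrank ℂ
      (Poly ⧸ (idealOfVars (Fin 2) ℂ ^ (M + K) ⊔ Ideal.span {P, Q})) := by
  set α := mulTruncated hP (k := K) rfl with hα
  set β := mulTruncated hQ (k := M) (add_comm M K) with hβ
  let π := (Ideal.Quotient.factorₐ ℂ (le_sup_left :
    idealOfVars (Fin 2) ℂ ^ (M + K) ≤ idealOfVars (Fin 2) ℂ ^ (M + K) ⊔ Ideal.span {P, Q}
    )).toLinearMap
  have hπ : Function.Surjective π := Ideal.Quotient.factor_surjective le_sup_left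
  have hker : LinearMap.ker π ≤ LinearMap.range α ⊔ LinearMap.range β := by
    intro x hx
    obtain ⟨f, rfl⟩ := Ideal.Quotient.mk_surjective x
    have hf : f ∈ idealOfVars (Fin 2) ℂ ^ (M + K) ⊔ Ideal.span {P, Q} :=
      Ideal.Quotient.eq_zero_iff_mem.1 hx
    obtain ⟨g, hg, h, hh, rfl⟩ := Submodule.mem_sup.1 hf
    obtain ⟨u, v, rfl⟩ := Ideal.mem_span_pair.1 hh
    refine Submodule.mem_sup.2 ⟨_, ⟨Ideal.Quotient.mk _ u, rfl⟩, _,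
      ⟨Ideal.Quotient.mk _ v, rfl⟩, ?_⟩
    rw [map_add, Ideal.Quotient.eq_zero_iff_mem.2 hg, zero_add, map_add, mul_comm u, mul_comm v]
    rfl
  have h1 := LinearMap.finrank_range_add_finrank_ker π
  rw [LinearMap.range_eq_top.2 hπ, finrank_top] at h1
  have h2 := (Submodule.finrank_mono hker).trans (Submodule.finrank_add_le_finrank_add_finrank _ _)
  have h3 := LinearMap.finrank_range_le α
  have h4 := LinearMap.finrank_range_le β
  have e1 := two_mul_finrank_quotient_pow (M + K)
  have e2 := two_mul_finrank_quotient_pow M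
  have e3 := two_mul_finrank_quotient_pow K
  nlinarith

theorem eval_translateTo (a w : Fin 2 → ℂ) (p : Poly) :
    eval w (translateTo a p) = eval (a + w) p := by
  rw [translateTo, ← coe_aeval_eq_eval, ← coe_aeval_eq_eval, RingHom.coe_coe, RingHom.coe_coe,
    aeval_bind₁]
  simp [Pi.add_def]

theorem translateTo_surjective (a : Fin 2 → ℂ) :
    Function.Surjective (translateTo a) := by
  intro p
  refine ⟨translateTo (-a) p, ?_⟩
  refine MvPolynomial.funext fun w => ?_
  simp [eval_translateTo]

theorem translateTo_sub_C_mem (a : Fin 2 → ℂ) (d : Poly) :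
    translateTo a d - C (eval a d) ∈ idealOfVars (Fin 2) ℂ := by
  rw [← pow_one (idealOfVars (Fin 2) ℂ), mem_pow_idealOfVars_iff']
  intro x hx
  obtain rfl : x = 0 := (Finsupp.degree_eq_zero_iff x).1 (by simpa using hx)
  have h := eval_translateTo a 0 d
  rw [eval_zero, constantCoeff_eq, add_zero] at h
  simp [h]

/-- The intersection multiplicity of coprime curves is at least the product of the orders of
vanishing. -/
theorem mul_le_intersectionMultiplicity {a : Fin 2 → ℂ} {p q r : Poly} (h : IsRelPrime p q)
    (hr : Ideal.span {p, r} = Ideal.span {p, q})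
    {M K : ℕ} (hp : translateTo a p ∈ idealOfVars (Fin 2) ℂ ^ M)
    (hK : translateTo a r ∈ idealOfVars (Fin 2) ℂ ^ K) :
    M * K ≤ intersectionMultiplicity a p q := by
  have hfin := finite_localRingAt_quotient a h
  rw [intersectionMultiplicity]
  refine (mul_le_finrank_quotient hp hK).trans ?_
  rw [← hr] at hfin ⊢
  set J := idealOfVars (Fin 2) ℂ ^ (M + K) ⊔ Ideal.span {translateTo a p, translateTo a r} with hJ
  let ψ : Poly →ₐ[ℂ] Poly ⧸ J := (Ideal.Quotient.mkₐ ℂ J).comp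
    (bind₁ (fun i => C (a i) + X i))
  have hψ : ∀ f, ψ f = Ideal.Quotient.mk J (translateTo a f) := fun _ => rfl
  -- In the truncation a denominator is its nonzero value at `a` plus a nilpotent, so `ψ` extends to
  -- the local ring.
  have hunit : ∀ d : (pointIdeal a).primeCompl, IsUnit (ψ d) := by
    intro d
    have hd : eval a (d : Poly) ≠ 0 := fun h0 => d.2 h0
    have hnil : IsNilpotent (Ideal.Quotient.mk J (translateTo a d - C (eval a (d : Poly)))) := by
      refine ⟨M + K, ?_⟩
      rw [← map_pow, Ideal.Quotient.eq_zero_iff_mem]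
      exact Ideal.mem_sup_left (Ideal.pow_mem_pow (translateTo_sub_C_mem a d) _)
    have hc : IsUnit (Ideal.Quotient.mk J (C (eval a (d : Poly)))) :=
      ((isUnit_iff_ne_zero.2 hd).map C).map _
    have := hnil.isUnit_add_right_of_commute hc (Commute.all _ _)
    rwa [← map_add, sub_add_cancel] at this
  let Ψ : LocalRingAt a →ₐ[ℂ] Poly ⧸ J := IsLocalization.liftAlgHom (f := ψ) hunit
  have hΨ : ∀ f : Poly, Ψ (algebraMap _ _ f) = ψ f := fun f => IsLocalization.lift_eq _ _
  have hle : ∀ x ∈ (Ideal.span {p, r}).map (algebraMap Poly (LocalRingAt a)), Ψ x = 0 := by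
    suffices (Ideal.span {p, r}).map (algebraMap Poly (LocalRingAt a)) ≤ RingHom.ker Ψ from
      fun x hx => this hx
    rw [Ideal.map_le_iff_le_comap, Ideal.span_le]
    rintro f hf
    have : Ψ (algebraMap _ _ f) = 0 := by
      rw [hΨ, hψ, Ideal.Quotient.eq_zero_iff_mem]
      refine Ideal.mem_sup_right (Ideal.subset_span ?_)
      rcases hf with rfl | rfl <;> simp
    exact this
  refine LinearMap.finrank_le_finrank_of_surjective
    (f := (Ideal.Quotient.liftₐ _ Ψ hle).toLinearMap) ?_
  intro x
  obtain ⟨y, rfl⟩ := Ideal.Quotient.mk_surjective x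
  obtain ⟨f, rfl⟩ := translateTo_surjective a y
  exact ⟨Ideal.Quotient.mk _ (algebraMap _ _ f), hΨ f⟩

end Bidisk

/-! ### One-variable tools: small polynomials, real roots, Hurwitz's theorem. -/

namespace Polynomial

/-- A polynomial that is `o(s ^ n)` as `s → 0+` has no terms of degree at most `n`. -/
theorem coeff_eq_zero_of_isLittleO {f : ℂ[X]} {n : ℕ}
    (hf : (fun s : ℝ => f.eval (s : ℂ)) =o[𝓝[>] 0] fun s : ℝ => (s : ℂ) ^ n) :
    ∀ j ≤ n, f.coeff j = 0 := by
  intro j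
  induction j using Nat.strong_induction_on with
  | _ j ih =>
    intro hj
    obtain ⟨g, hg⟩ := X_pow_dvd_iff.2 fun i hi => ih i hi (hi.le.trans hj)
    have hcoeff : f.coeff j = g.eval 0 := by
      rw [hg, ← coeff_zero_eq_eval_zero]
      simpa using coeff_X_pow_mul g j 0
    have h1 : Tendsto (fun s : ℝ => g.eval (s : ℂ)) (𝓝[>] 0) (𝓝 (g.eval 0)) := by
      have : Continuous fun s : ℝ => g.eval (s : ℂ) := by fun_prop
      simpa using (this.tendsto 0).mono_left nhdsWithin_le_nhds
    -- This is `f / s ^ j = g`; its limit is `0` even when `n = j`, because the first factor tends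
    -- to `0`.
    have h2 : Tendsto (fun s : ℝ => f.eval (s : ℂ) / (s : ℂ) ^ n * (s : ℂ) ^ (n - j)) (𝓝[>] 0)
        (𝓝 (0 * (0 : ℂ) ^ (n - j))) := by
      refine hf.tendsto_div_nhds_zero.mul ?_
      have : Continuous fun s : ℝ => (s : ℂ) ^ (n - j) := by fun_prop
      simpa using (this.tendsto 0).mono_left nhdsWithin_le_nhds
    rw [zero_mul] at h2
    rw [hcoeff]
    refine tendsto_nhds_unique (h1.congr' ?_) h2
    filter_upwards [self_mem_nhdsWithin] with s hs
    have hs' : (s : ℂ) ≠ 0 := Complex.ofReal_ne_zero.2 (ne_of_gt hs)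
    rw [hg, eval_mul, eval_pow, eval_X]
    have : (s : ℂ) ^ n = s ^ j * s ^ (n - j) := by rw [← pow_add, Nat.add_sub_cancel' hj]
    rw [this]
    field_simp

/-- If all roots of `f` are real, conjugating the values of `f` at real points only multiplies them
by a constant. -/
theorem exists_conj_eval_eq {f : ℂ[X]} (hf : ∀ t, f.eval t = 0 → t.im = 0) :
    ∃ κ : ℂ, ∀ y : ℝ, starRingEnd ℂ (f.eval (y : ℂ)) = κ * f.eval (y : ℂ) := by
  rcases eq_or_ne f 0 with rfl | h0
  · exact ⟨0, by simp⟩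
  -- Each factor `y - t` is real, so only the leading coefficient feels the conjugation.
  refine ⟨starRingEnd ℂ f.leadingCoeff / f.leadingCoeff, fun y => ?_⟩
  have hl : f.leadingCoeff ≠ 0 := leadingCoeff_ne_zero.2 h0
  have hprod : starRingEnd ℂ (f.roots.map ((y : ℂ) - ·)).prod =
      (f.roots.map ((y : ℂ) - ·)).prod := by
    rw [map_multiset_prod, Multiset.map_map]
    congr 1
    refine Multiset.map_congr rfl fun t ht => ?_
    have : starRingEnd ℂ t = t := Complex.conj_eq_iff_im.2 (hf t ((mem_roots h0).1 ht))
    simp [this]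
  rw [(IsAlgClosed.splits f).eval_eq_prod_roots, map_mul, hprod]
  field_simp

end Polynomial

/-- Hurwitz's theorem for a continuous one-parameter family of entire functions: zeros do not appear
suddenly in the limit. -/
theorem ne_zero_of_eventually_ne_zero {Φ : ℝ × ℂ → ℂ} {t₀ : ℂ} (hc : Continuous Φ)
    (hd : ∀ s, Differentiable ℂ fun t => Φ (s, t))
    (hne : ∀ᶠ z in 𝓝 ((0 : ℝ), t₀), 0 < z.1 → Φ z ≠ 0)
    (hiso : ∀ᶠ t in 𝓝[≠] t₀, Φ (0, t) ≠ 0) : Φ (0, t₀) ≠ 0 := by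
  intro h0
  obtain ⟨ε, hε, hball⟩ := Metric.eventually_nhds_iff.1 hne
  obtain ⟨δ, hδ, hdel⟩ := Metric.eventually_nhds_iff.1 (eventually_nhdsWithin_iff.1 hiso)
  obtain ⟨r, hr, hr'⟩ := exists_between (lt_min hε hδ)
  have hsph : IsCompact (Metric.sphere t₀ r) := isCompact_sphere _ _
  have hpos : ∀ t ∈ Metric.sphere t₀ r, 0 < ‖Φ (0, t)‖ := fun t ht => by
    refine norm_pos_iff.2
      (hdel (by rw [Metric.mem_sphere.1 ht]; exact hr'.trans_le (min_le_right _ _)) ?_)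
    rintro rfl
    simp at ht
    exact hr.ne ht
  obtain ⟨t₁, ht₁, hmin⟩ := hsph.exists_isMinOn (NormedSpace.sphere_nonempty.2 hr.le)
    (f := fun t => ‖Φ (0, t)‖) (by fun_prop)
  set m := ‖Φ (0, t₁)‖ with hm
  have hm0 : 0 < m := hpos t₁ ht₁
  have e1 : ∀ᶠ s in 𝓝 (0 : ℝ), ∀ t ∈ Metric.sphere t₀ r, m / 2 < ‖Φ (s, t)‖ := by
    refine hsph.eventually_forall_of_forall_eventually fun t ht => ?_
    refine (hc.norm.tendsto (0, t)).eventually (lt_mem_nhds ?_)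
    have : m ≤ ‖Φ (0, t)‖ := hmin ht
    linarith
  have e2 : ∀ᶠ s in 𝓝 (0 : ℝ), ‖Φ (s, t₀)‖ < m / 2 := by
    have : Continuous fun s => ‖Φ (s, t₀)‖ := by fun_prop
    refine (this.tendsto 0).eventually (gt_mem_nhds ?_)
    rw [h0, norm_zero]
    positivity
  have e3 : ∀ᶠ s in 𝓝 (0 : ℝ), s < ε := gt_mem_nhds hε
  obtain ⟨s, ⟨⟨h1, h2⟩, h3⟩, hs⟩ :=
    (((e1.and e2).and e3).filter_mono nhdsWithin_le_nhds |>.and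
      (self_mem_nhdsWithin (s := Set.Ioi (0 : ℝ)))).exists
  have hnz : ∀ t ∈ Metric.closedBall t₀ r, Φ (s, t) ≠ 0 := fun t ht => by
    refine hball ?_ hs
    rw [Prod.dist_eq]
    refine max_lt ?_ ((Metric.mem_closedBall.1 ht).trans_lt (hr'.trans_le (min_le_left _ _)))
    simpa [abs_of_pos (show 0 < s from hs)] using h3
  -- The maximum principle for `1 / Φ (s, ·)` is contradicted: `‖Φ‖` exceeds `m / 2` on the circle
  -- but is below `m / 2` at its centre.
  have hdiff : DiffContOnCl ℂ (fun t => (Φ (s, t))⁻¹) (Metric.ball t₀ r) := by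
    refine DifferentiableOn.diffContOnCl ?_
    rw [closure_ball t₀ hr.ne']
    exact fun t ht => ((hd s t).inv (hnz t ht)).differentiableWithinAt
  have hmax := Complex.norm_le_of_forall_mem_frontier_norm_le Metric.isBounded_ball hdiff
    (C := (m / 2)⁻¹) (fun t ht => by
      rw [frontier_ball t₀ hr.ne'] at ht
      rw [norm_inv]
      exact inv_anti₀ (by positivity) (h1 t ht).le) (subset_closure (Metric.mem_ball_self hr))
  rw [norm_inv] at hmax
  have := (inv_le_inv₀ (norm_pos_iff.2 (hnz t₀ (Metric.mem_closedBall_self hr.le)))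
    (by positivity)).1 hmax
  linarith

/-! ### Homogeneous expansions along rays. -/

namespace Bidisk

open MvPolynomial

theorem eval_smul_of_isHomogeneous {F : Poly} {j : ℕ} (hF : F.IsHomogeneous j) (s : ℂ)
    (w : Fin 2 → ℂ) : eval (s • w) F = s ^ j * eval w F := by
  rw [eval_eq, eval_eq, Finset.mul_sum]
  refine Finset.sum_congr rfl fun d hd => ?_
  have hdeg : ∑ i ∈ d.support, d i = j := by
    have h : d.degree = j := by
      rw [Finsupp.degree_eq_weight_one]
      exact hF (mem_support_iff.1 hd)
    rwa [Finsupp.degree_apply] at h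
  simp only [Pi.smul_apply, smul_eq_mul, mul_pow, Finset.prod_mul_distrib,
    Finset.prod_pow_eq_pow_sum, hdeg]
  ring

theorem eval_smul_eq_sum (F : Poly) (s : ℂ) (w : Fin 2 → ℂ) :
    eval (s • w) F =
      ∑ j ∈ Finset.range (F.totalDegree + 1), s ^ j * eval w (homogeneousComponent j F) := by
  conv_lhs => rw [← sum_homogeneousComponent F, map_sum]
  exact Finset.sum_congr rfl fun j _ =>
    eval_smul_of_isHomogeneous (homogeneousComponent_isHomogeneous j F) s w

/-- The family `s⁻ᴹ F(s w)`, extended to `s = 0` by the term of degree `M` of `F`. -/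
noncomputable def blowup (M : ℕ) (F : Poly) (s : ℂ) (w : Fin 2 → ℂ) : ℂ :=
  ∑ j ∈ Finset.range (F.totalDegree + 1), s ^ (j - M) * eval w (homogeneousComponent j F)

theorem eval_smul_eq_blowup {M : ℕ} {F : Poly} (hF : ∀ j < M, homogeneousComponent j F = 0) (s : ℂ)
    (w : Fin 2 → ℂ) : eval (s • w) F = s ^ M * blowup M F s w := by
  rw [eval_smul_eq_sum, blowup, Finset.mul_sum]
  refine Finset.sum_congr rfl fun j _ => ?_
  -- For `j < M` the exponent `j - M` truncates to `0`, which is harmless as the component vanishes.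
  rcases lt_or_ge j M with h | h
  · simp [hF j h]
  · rw [← mul_assoc, ← pow_add, Nat.add_sub_cancel' h]

theorem blowup_zero {M : ℕ} {F : Poly} (hF : ∀ j < M, homogeneousComponent j F = 0)
    (w : Fin 2 → ℂ) : blowup M F 0 w = eval w (homogeneousComponent M F) := by
  rw [blowup, Finset.sum_eq_single M]
  · simp
  · intro j _ hj
    rcases lt_or_gt_of_ne hj with h | h
    · simp [hF j h]
    · rw [zero_pow (by omega), zero_mul]
  · intro h
    rw [homogeneousComponent_eq_zero _ _ (by simpa using h)]
    simp

theorem continuous_blowup (M : ℕ) (F : Poly) :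
    Continuous fun x : ℂ × (Fin 2 → ℂ) => blowup M F x.1 x.2 := by
  unfold blowup
  refine continuous_finsetSum _ fun j _ => (continuous_fst.pow _).mul ?_
  exact (MvPolynomial.continuous_eval _).comp continuous_snd

/-- If `F` is `o(s ^ n)` along a ray, its components of degree at most `n` vanish there. -/
theorem eval_homogeneousComponent_eq_zero_of_isLittleO {F : Poly} {w : Fin 2 → ℂ} {n : ℕ}
    (h : (fun s : ℝ => eval ((s : ℂ) • w) F) =o[𝓝[>] 0] fun s : ℝ => (s : ℂ) ^ n) :
    ∀ j ≤ n, eval w (homogeneousComponent j F) = 0 := by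
  set f : Polynomial ℂ := ∑ j ∈ Finset.range (F.totalDegree + 1),
    Polynomial.monomial j (eval w (homogeneousComponent j F)) with hf
  have hcoeff : ∀ j, f.coeff j = eval w (homogeneousComponent j F) := by
    intro j
    simp only [hf, Polynomial.finsetSum_coeff, Polynomial.coeff_monomial, Finset.sum_ite_eq',
      Finset.mem_range]
    split_ifs with hj
    · rfl
    · rw [homogeneousComponent_eq_zero _ _ (by omega), map_zero]
  have heval : ∀ s : ℂ, f.eval s = eval (s • w) F := by
    intro s
    rw [eval_smul_eq_sum, hf, Polynomial.eval_finsetSum]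
    exact Finset.sum_congr rfl fun j _ => by rw [Polynomial.eval_monomial, mul_comm]
  intro j hj
  rw [← hcoeff]
  refine Polynomial.coeff_eq_zero_of_isLittleO ?_ j hj
  simpa only [heval] using h

/-- The restriction of a polynomial to the line `{(b₀, b₁ t)}`. -/
noncomputable def restrictLine (b : Fin 2 → ℂ) (F : Poly) : Polynomial ℂ :=
  aeval ![Polynomial.C (b 0), Polynomial.C (b 1) * Polynomial.X] F

theorem eval_restrictLine (b : Fin 2 → ℂ) (F : Poly) (t : ℂ) :
    (restrictLine b F).eval t = eval ![b 0, b 1 * t] F := by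
  rw [restrictLine, ← Polynomial.coe_evalRingHom, ← coe_aeval_eq_eval, RingHom.coe_coe,
    aeval_def, hom_eval₂, aeval_def]
  congr 1
  · ext; simp
  · ext i; fin_cases i <;> simp

theorem restrictLine_ne_zero {b : Fin 2 → ℂ} (hb : ∀ i, b i ≠ 0) {F : Poly} {j : ℕ}
    (hF : F.IsHomogeneous j) (h0 : F ≠ 0) : restrictLine b F ≠ 0 := by
  intro h
  -- Scaling the line reaches only points with `w 0 ≠ 0`; the factor `X 0` takes care of the others.
  refine h0 ((mul_eq_zero.1 (?_ : X 0 * F = 0)).resolve_left (X_ne_zero 0))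
  refine MvPolynomial.funext fun w => ?_
  rw [map_mul, eval_X, map_zero]
  rcases eq_or_ne (w 0) 0 with hw | hw
  · simp [hw]
  · have : w = (w 0 / b 0) • ![b 0, b 1 * (w 1 * b 0 / (w 0 * b 1))] := by
      have := hb 0
      have := hb 1
      ext i
      fin_cases i
      · simp [hb 0]
      · simp
        field_simp
    rw [this, eval_smul_of_isHomogeneous hF, ← eval_restrictLine, h]
    simp

end Bidisk

/-! ### Reduction to rays, and real-rootedness of the lowest form. -/

namespace Bidisk

open MvPolynomial

theorem translateTo_mem_pow_iff {a : Fin 2 → ℂ} {p : Poly} {n : ℕ} :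
    translateTo a p ∈ idealOfVars (Fin 2) ℂ ^ n ↔
      ∀ j < n, homogeneousComponent j (translateTo a p) = 0 := by
  rw [mem_pow_idealOfVars_iff']
  constructor
  · intro h j hj
    ext x
    rw [coeff_homogeneousComponent, coeff_zero]
    split_ifs with hx
    · exact h x (hx ▸ hj)
    · rfl
  · intro h x hx
    simpa [coeff_homogeneousComponent] using congrArg (coeff x) (h _ hx)

/-- A point on the ray through `(1, y)` in the coordinates `ζ`. -/
theorem mul_one_sub_eq (a : Fin 2 → ℂ) (s y : ℂ) :
    (fun i => a i * (1 - (s • ![1, y]) i)) = a + s • ![(-a) 0, (-a) 1 * y] := by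
  ext i
  fin_cases i <;> simp <;> ring

/-- Each component of degree at most `n`, restricted to the line of slopes, is a one-variable
polynomial with every point of `(1, 2)` as a root. The slopes are kept in this interval so that the
rays lie in a fixed approach region. -/
theorem homogeneousComponent_eq_zero_of_rays {a : Fin 2 → ℂ} (ha : ∀ i, a i ≠ 0) {r : Poly} {n : ℕ}
    (h : ∀ y ∈ Set.Ioo (1 : ℝ) 2,
      (fun s : ℝ => eval (a + (s : ℂ) • ![(-a) 0, (-a) 1 * (y : ℂ)]) r)
        =o[𝓝[>] 0] fun s : ℝ => (s : ℂ) ^ n) :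
    ∀ j < n + 1, homogeneousComponent j (translateTo a r) = 0 := by
  intro j hj
  by_contra h0
  refine restrictLine_ne_zero (b := -a) (by simpa using ha)
    (homogeneousComponent_isHomogeneous _ _) h0 ?_
  refine Polynomial.eq_zero_of_infinite_isRoot _ (Set.Infinite.mono ?_
    ((Set.Ioo_infinite (show (1 : ℝ) < 2 by norm_num)).image Complex.ofReal_injective.injOn))
  rintro _ ⟨y, hy, rfl⟩
  rw [Set.mem_ofPred_eq, Polynomial.IsRoot, eval_restrictLine]
  refine eval_homogeneousComponent_eq_zero_of_isLittleO ?_ j (Nat.lt_succ_iff.1 hj)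
  simpa only [eval_translateTo] using h y hy

theorem mul_le_intersectionMultiplicity_of_rays {p : Poly} (hp : SemiStable p) {a : Fin 2 → ℂ}
    (ha : ∀ i, a i ≠ 0) {M n : ℕ} (hM : VanishesToOrder p a M) (L : Poly)
    (h : ∀ y ∈ Set.Ioo (1 : ℝ) 2,
      (fun s : ℝ => eval (a + (s : ℂ) • ![(-a) 0, (-a) 1 * (y : ℂ)]) (reflection p - L * p))
        =o[𝓝[>] 0] fun s : ℝ => (s : ℂ) ^ n) :
    M * (n + 1) ≤ intersectionMultiplicity a p (reflection p) := by
  refine mul_le_intersectionMultiplicity (r := reflection p - L * p) hp.no_common_factor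
    (Ideal.span_pair_sub_mul_left _ _ _)
    (translateTo_mem_pow_iff.2 hM.1)
    (translateTo_mem_pow_iff.2 (homogeneousComponent_eq_zero_of_rays ha h))

/-- The lowest order term of a polynomial without zeros in the bidisk has only real zeros in the
ratio `ζ₂ / ζ₁`. -/
theorem im_eq_zero_of_eval_bottom {p : Poly} (hp : SemiStable p) {a : Fin 2 → ℂ}
    (ha : ∀ i, ‖a i‖ = 1) {M : ℕ} (hM : VanishesToOrder p a M) {t : ℂ}
    (ht : (restrictLine (-a) (homogeneousComponent M (translateTo a p))).eval t = 0) :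
    t.im = 0 := by
  by_contra him
  have ha0 : ∀ i, (-a) i ≠ 0 := fun i h => by
    have := ha i
    rw [Pi.neg_apply, neg_eq_zero] at h
    simp [h] at this
  set G := homogeneousComponent M (translateTo a p) with hG
  have hGhom : G.IsHomogeneous M := homogeneousComponent_isHomogeneous _ _
  set f := restrictLine (-a) G with hf
  have hf0 : f ≠ 0 := restrictLine_ne_zero ha0 hGhom hM.2
  have htn : 0 < ‖t‖ := norm_pos_iff.2 (by rintro rfl; simp at him)
  have hre : 0 < ‖t‖ + t.re := by
    have := Complex.abs_re_lt_norm.2 him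
    have := neg_abs_le t.re
    linarith
  -- Chosen so that both `u` and `u * t = ‖t‖ * (t + ‖t‖)` have positive real part: `(u, u * t)` is
  -- a direction of ratio `t` pointing into the bidisk.
  set u : ℂ := ‖t‖ + starRingEnd ℂ t with hu
  have hure : 0 < u.re := by simpa [hu] using hre
  have hutre : 0 < (u * t).re := by
    have : u * t = ‖t‖ * (t + ‖t‖) := by
      rw [hu, add_mul, mul_comm (starRingEnd ℂ t), Complex.mul_conj, Complex.normSq_eq_norm_sq]
      push_cast
      ring
    rw [this, Complex.re_ofReal_mul]
    simp only [Complex.add_re, Complex.ofReal_re]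
    exact mul_pos htn (by linarith)
  have hu0 : u ≠ 0 := by
    intro h
    simp [h] at hure
  let w : ℂ → Fin 2 → ℂ := fun t' => u • ![(-a) 0, (-a) 1 * t']
  have hw : ∀ t', eval (w t') G = u ^ M * f.eval t' := fun t' => by
    rw [eval_smul_of_isHomogeneous hGhom, hf, eval_restrictLine]
  have hwd : ∀ i, Differentiable ℂ fun t' => w t' i := by
    intro i
    fin_cases i
    · simp [w]
    · simp [w]
      fun_prop
  have hwc : Continuous w := continuous_pi fun i => (hwd i).continuous
  let Φ : ℝ × ℂ → ℂ := fun z => blowup M (translateTo a p) z.1 (w z.2)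
  have hΦ0 : ∀ t', Φ (0, t') = u ^ M * f.eval t' := fun t' => by
    simp only [Φ, Complex.ofReal_zero, blowup_zero hM.1, ← hw, hG]
  -- For small `s > 0` and ratios near `t`, a zero of `Φ` would be a zero of `p` in the bidisk; at
  -- `s = 0` the family is a multiple of `f`, whose zeros are isolated.
  refine ne_zero_of_eventually_ne_zero (Φ := Φ) (t₀ := t) ?_ ?_ ?_ ?_ (by rw [hΦ0, ht, mul_zero])
  · exact (continuous_blowup _ _).comp
      ((Complex.continuous_ofReal.comp continuous_fst).prodMk (hwc.comp continuous_snd))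
  · intro s
    simp only [Φ, blowup]
    refine Differentiable.fun_sum fun j _ => Differentiable.const_mul ?_ _
    simp only [w, eval_smul_of_isHomogeneous (homogeneousComponent_isHomogeneous j _),
      ← eval_restrictLine]
    exact (Polynomial.differentiable _).const_mul _
  · have hdisk : ∀ (ζ : ℂ → ℂ), Continuous ζ → 0 < (ζ t).re →
        ∀ᶠ z : ℝ × ℂ in 𝓝 (0, t), 0 < z.1 → ‖1 - z.1 * ζ z.2‖ < 1 := by
      intro ζ hζ hpos
      -- For `s > 0`, `‖1 - s * ζ‖ < 1` amounts to `s * ‖ζ‖ ^ 2 < 2 * Re ζ`.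
      have hc : Continuous fun z : ℝ × ℂ => z.1 * ‖ζ z.2‖ ^ 2 - 2 * (ζ z.2).re := by fun_prop
      have : ∀ᶠ z : ℝ × ℂ in 𝓝 (0, t), z.1 * ‖ζ z.2‖ ^ 2 - 2 * (ζ z.2).re < 0 :=
        (hc.tendsto (0, t)).eventually (gt_mem_nhds (by simpa using hpos))
      filter_upwards [this] with z hz hz0
      rw [← sq_lt_one_iff₀ (norm_nonneg _), ← Complex.normSq_eq_norm_sq, Complex.normSq_apply]
      rw [← Complex.normSq_eq_norm_sq, Complex.normSq_apply] at hz
      simp only [Complex.sub_re, Complex.one_re, Complex.sub_im, Complex.one_im,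
        Complex.re_ofReal_mul, Complex.im_ofReal_mul]
      nlinarith [mul_neg_of_pos_of_neg hz0 hz]
    filter_upwards [hdisk (fun _ => u) continuous_const hure,
      hdisk (fun t' => u * t') (by fun_prop) hutre] with z h0 h1 hz hΦ
    have h2 := eval_smul_eq_blowup hM.1 z.1 (w z.2)
    rw [eval_translateTo, show blowup M (translateTo a p) z.1 (w z.2) = 0 from hΦ, mul_zero] at h2
    refine hp.ne_zero_of_mem_bidisk _ (fun i => ?_) h2
    fin_cases i
    · have : (a + (z.1 : ℂ) • w z.2) 0 = a 0 * (1 - z.1 * u) := by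
        simp [w]; ring
      change ‖(a + (z.1 : ℂ) • w z.2) 0‖ < 1
      rw [this, norm_mul, ha, one_mul]
      exact h0 hz
    · have : (a + (z.1 : ℂ) • w z.2) 1 = a 1 * (1 - z.1 * (u * z.2)) := by
        simp [w]; ring
      change ‖(a + (z.1 : ℂ) • w z.2) 1‖ < 1
      rw [this, norm_mul, ha, one_mul]
      exact h1 hz
  · have hfin : ({t' | f.IsRoot t'} \ {t}).Finite := (Polynomial.finite_setOfPred_isRoot hf0).sdiff
    have := hfin.isClosed.isOpen_compl.mem_nhds (show t ∉ {t' | f.IsRoot t'} \ {t} by simp)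
    filter_upwards [mem_nhdsWithin_of_mem_nhds this, self_mem_nhdsWithin] with t' h1 h2
    rw [hΦ0]
    exact mul_ne_zero (pow_ne_zero _ hu0) fun h => h1 ⟨h, h2⟩

end Bidisk

/-! ### Cancellation between `p` and its reflection along rays. -/

namespace Bidisk

open MvPolynomial

/-- The direction may vary with `s`, because reflecting a ray in the torus gives a curve that is
only tangent to a ray. -/
theorem tendsto_eval_div_pow {p : Poly} {a : Fin 2 → ℂ} {M : ℕ} (hM : VanishesToOrder p a M)
    {w : ℝ → Fin 2 → ℂ} {w₀ : Fin 2 → ℂ} (hw : Tendsto w (𝓝[>] 0) (𝓝 w₀)) :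
    Tendsto (fun s : ℝ => eval (a + (s : ℂ) • w s) p / (s : ℂ) ^ M) (𝓝[>] 0)
      (𝓝 (eval w₀ (homogeneousComponent M (translateTo a p)))) := by
  have hs : Tendsto (fun s : ℝ => (s : ℂ)) (𝓝[>] 0) (𝓝 0) := by
    simpa using (Complex.continuous_ofReal.tendsto 0).mono_left nhdsWithin_le_nhds
  have h := ((continuous_blowup M (translateTo a p)).tendsto (0, w₀)).comp (hs.prodMk_nhds hw)
  simp only [blowup_zero hM.1] at h
  refine h.congr' ?_
  filter_upwards [self_mem_nhdsWithin] with s hs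
  have hs' : (s : ℂ) ≠ 0 := Complex.ofReal_ne_zero.2 (ne_of_gt hs)
  rw [← eval_translateTo, eval_smul_eq_blowup hM.1, mul_div_cancel_left₀ _ (pow_ne_zero _ hs')]
  rfl

/-- The lowest order terms of `p` and of its reflection are proportional. -/
theorem exists_reflection_sub_isLittleO {p : Poly} (hp : SemiStable p) {a : Fin 2 → ℂ}
    (ha : ∀ i, ‖a i‖ = 1) {M : ℕ} (hM : VanishesToOrder p a M) :
    ∃ μ : ℂ, ∀ y ∈ Set.Ioo (1 : ℝ) 2,
      (fun s : ℝ => eval (a + (s : ℂ) • ![(-a) 0, (-a) 1 * (y : ℂ)]) (reflection p - C μ * p))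
        =o[𝓝[>] 0] fun s : ℝ => (s : ℂ) ^ M := by
  obtain ⟨κ, hκ⟩ := Polynomial.exists_conj_eval_eq fun t =>
    im_eq_zero_of_eval_bottom hp ha hM (t := t)
  have ha0 : ∀ i, a i ≠ 0 := fun i h => by simpa [h] using ha i
  have haconj : ∀ i, 1 / starRingEnd ℂ (a i) = a i := fun i => by
    rw [one_div, ← Complex.inv_eq_conj (ha i), inv_inv]
  set G := homogeneousComponent M (translateTo a p) with hG
  -- The monomial is the limit of the prefactor in `eval_reflection`, the sign comes from the
  -- reversal `b ↦ -b` in a form of degree `M`, and `κ` from conjugating real-rooted values.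
  refine ⟨a 0 ^ p.degreeOf 0 * a 1 ^ p.degreeOf 1 * (-1) ^ M * κ, fun y hy => ?_⟩
  set v : Fin 2 → ℂ := ![1, (y : ℂ)] with hv
  set b : Fin 2 → ℂ := ![(-a) 0, (-a) 1 * (y : ℂ)] with hb
  have hbv : ∀ i, b i = -(a i * v i) := by intro i; fin_cases i <;> simp [hb, hv]
  have hvconj : ∀ i, starRingEnd ℂ (v i) = v i := by intro i; fin_cases i <;> simp [hv]
  -- The reflected point has coordinates `a i / (1 - s * v i) = a i + s * w s i`.
  set w : ℝ → Fin 2 → ℂ := fun s i => a i * v i / (1 - s * v i) with hw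
  have hs : Tendsto (fun s : ℝ => (s : ℂ)) (𝓝[>] 0) (𝓝 0) := by
    simpa using (Complex.continuous_ofReal.tendsto 0).mono_left nhdsWithin_le_nhds
  have hden : ∀ i, Tendsto (fun s : ℝ => 1 - (s : ℂ) * v i) (𝓝[>] 0) (𝓝 1) := fun i => by
    simpa using (hs.mul_const (v i)).const_sub 1
  have hdenne : ∀ᶠ s : ℝ in 𝓝[>] 0, ∀ i, 1 - (s : ℂ) * v i ≠ 0 :=
    eventually_all.2 fun i => (hden i).eventually_ne one_ne_zero
  have hwlim : Tendsto w (𝓝[>] 0) (𝓝 (-b)) := by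
    refine tendsto_pi_nhds.2 fun i => ?_
    have := (tendsto_const_nhds (x := a i * v i)).div (hden i) one_ne_zero
    simpa [hw, hbv, Pi.div_def] using this
  have hlim₁ := tendsto_eval_div_pow hM (tendsto_const_nhds (x := b) (f := 𝓝[>] (0 : ℝ)))
  have hlim₂ := tendsto_eval_div_pow hM hwlim
  have hpre : Tendsto (fun s : ℝ => (a 0 * (1 - s * v 0)) ^ p.degreeOf 0 *
      (a 1 * (1 - s * v 1)) ^ p.degreeOf 1) (𝓝[>] 0)
      (𝓝 (a 0 ^ p.degreeOf 0 * a 1 ^ p.degreeOf 1)) := by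
    simpa using (((hden 0).const_mul (a 0)).pow (p.degreeOf 0)).mul
      (((hden 1).const_mul (a 1)).pow (p.degreeOf 1))
  have hlim := (hpre.mul ((Complex.continuous_conj.tendsto _).comp hlim₂)).sub
    (hlim₁.const_mul (a 0 ^ p.degreeOf 0 * a 1 ^ p.degreeOf 1 * (-1) ^ M * κ))
  have hzero : a 0 ^ p.degreeOf 0 * a 1 ^ p.degreeOf 1 * starRingEnd ℂ (eval (-b) G) -
      a 0 ^ p.degreeOf 0 * a 1 ^ p.degreeOf 1 * (-1) ^ M * κ * eval b G = 0 := by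
    have h1 : eval (-b) G = (-1) ^ M * eval b G := by
      rw [← eval_smul_of_isHomogeneous (homogeneousComponent_isHomogeneous M _)]
      rw [neg_one_smul]
    have h2 := hκ y
    rw [eval_restrictLine] at h2
    rw [h1, map_mul, h2]
    simp only [map_pow, map_neg, map_one]
    ring
  rw [hzero] at hlim
  refine (isLittleO_iff_tendsto' ?_).2 (hlim.congr' ?_)
  · filter_upwards [self_mem_nhdsWithin] with s hs h
    exact absurd h (pow_ne_zero _ (Complex.ofReal_ne_zero.2 (ne_of_gt hs)))
  · filter_upwards [hdenne] with s hd
    have hpt : ∀ i, (a + (s : ℂ) • b) i = a i * (1 - s * v i) := fun i => by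
      simp only [Pi.add_apply, Pi.smul_apply, smul_eq_mul, hbv]
      ring
    have hrefl : (fun i => 1 / starRingEnd ℂ ((a + (s : ℂ) • b) i)) = a + (s : ℂ) • w s := by
      ext i
      rw [hpt, map_mul, map_sub, map_mul, map_one, Complex.conj_ofReal, hvconj, ← div_div,
        haconj]
      simp only [hw, Pi.add_apply, Pi.smul_apply, smul_eq_mul]
      have := hd i
      field_simp
      ring
    rw [map_sub, map_mul, eval_C, eval_reflection _ _ fun i => by
      rw [hpt]; exact mul_ne_zero (ha0 i) (hd i), hrefl, hpt, hpt]
    simp only [Function.comp_apply, map_div₀, map_pow, Complex.conj_ofReal]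
    ring

theorem isLittleO_of_nontangentiallyC {p : Poly} (hp : SemiStable p) {a : Fin 2 → ℂ}
    (ha : ∀ i, ‖a i‖ = 1) {M k : ℕ} (hM : VanishesToOrder p a M)
    (h : NontangentiallyC k (fun z => eval z (reflection p) / eval z p) a) :
    ∃ L : Poly, ∀ y ∈ Set.Ioo (1 : ℝ) 2,
      (fun s : ℝ => eval (a + (s : ℂ) • ![(-a) 0, (-a) 1 * (y : ℂ)]) (reflection p - L * p))
        =o[𝓝[>] 0] fun s : ℝ => (s : ℂ) ^ (M + k) := by
  obtain ⟨L, -, hL⟩ := h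
  have ha0 : ∀ i, a i ≠ 0 := fun i h => by simpa [h] using ha i
  -- The substitution `ζ i = 1 - z i / a i` rewrites the Taylor polynomial in the original
  -- coordinates.
  refine ⟨bind₁ (fun i => 1 - C (a i)⁻¹ * X i) L, fun y hy => ?_⟩
  obtain ⟨hy1, hy2⟩ := hy
  set b : Fin 2 → ℂ := ![(-a) 0, (-a) 1 * (y : ℂ)] with hb
  set ζ : ℝ → Fin 2 → ℂ := fun s => (s : ℂ) • ![1, (y : ℂ)] with hζ
  have hζpt : ∀ s, (fun i => a i * (1 - ζ s i)) = a + (s : ℂ) • b := fun s => mul_one_sub_eq a s y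
  -- On these rays all four comparables lie in `[s, 2 * s]`, so their ratios are at most `2` and
  -- aperture `3` suffices.
  have htend : Tendsto ζ (𝓝[>] 0) (𝓝[approachRegion 3] 0) := by
    refine tendsto_nhdsWithin_iff.2 ⟨?_, ?_⟩
    · have : Continuous ζ := by fun_prop
      have h0 : ζ 0 = 0 := by simp only [hζ, Complex.ofReal_zero, zero_smul]
      exact h0 ▸ (this.tendsto 0).mono_left nhdsWithin_le_nhds
    · filter_upwards [self_mem_nhdsWithin] with s hs
      have hs0 : 0 < s := hs
      have hcomp : ∀ x ∈ comparables (ζ s), s ≤ x ∧ x ≤ 2 * s := by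
        have h0 : 0 < y := by linarith
        intro x hx
        simp only [comparables, hζ, Set.mem_insert_iff, Set.mem_singleton_iff, Pi.smul_apply,
          Matrix.cons_val_zero, Matrix.cons_val_one, smul_eq_mul, mul_one, norm_mul,
          Complex.norm_real, Real.norm_eq_abs, abs_of_pos hs0, abs_of_pos h0, Complex.ofReal_re,
          ← Complex.ofReal_mul] at hx
        rcases hx with rfl | rfl | rfl | rfl <;> constructor <;> nlinarith
      refine ⟨fun i => ?_, fun x hx z hz => ?_⟩
      · have := (hcomp (ζ s i).re (by fin_cases i <;> simp [comparables])).1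
        linarith
      · obtain ⟨hx1, hx2⟩ := hcomp x hx
        obtain ⟨hz1, hz2⟩ := hcomp z hz
        have hz0 : 0 < z := by linarith
        rw [le_div_iff₀ hz0, div_le_iff₀ hz0]
        constructor <;> linarith
  have hO := (hL 3 (by norm_num)).comp_tendsto htend
  have hp0 : ∀ᶠ s : ℝ in 𝓝[>] 0, eval (a + (s : ℂ) • b) p ≠ 0 := by
    -- As `y < 2`, the bound `s < 1 / 2` gives `s * y < 1`, which keeps the point in the bidisk.
    filter_upwards [Ioo_mem_nhdsGT (show (0 : ℝ) < 1 / 2 by norm_num)] with s hs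
    refine hp.ne_zero_of_mem_bidisk _ fun i => ?_
    have : ∀ x : ℝ, 0 < x → x < 1 → ‖a i * (1 - (x : ℂ))‖ < 1 := fun x h0 h1 => by
      rw [norm_mul, ha, one_mul, ← Complex.ofReal_one, ← Complex.ofReal_sub, Complex.norm_real,
        Real.norm_eq_abs, abs_lt]
      constructor <;> linarith
    rw [← hζpt]
    obtain ⟨h0, h1⟩ := hs
    fin_cases i
    · simpa [hζ] using this s h0 (by linarith)
    · simpa [hζ] using this (s * y) (by nlinarith) (by nlinarith)
  have hpO : (fun s : ℝ => eval (a + (s : ℂ) • b) p) =O[𝓝[>] 0] fun s : ℝ => (s : ℂ) ^ M := by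
    have := (tendsto_eval_div_pow hM (tendsto_const_nhds (x := b) (f := 𝓝[>] (0 : ℝ)))).isBigO_one ℂ
    refine ((this.mul (isBigO_refl (fun s : ℝ => (s : ℂ) ^ M) _))).congr' ?_ (by simp)
    filter_upwards [self_mem_nhdsWithin] with s hs
    exact div_mul_cancel₀ _ (pow_ne_zero _ (Complex.ofReal_ne_zero.2 (ne_of_gt hs)))
  have hO' : (fun s : ℝ => eval (a + (s : ℂ) • b) (reflection p) / eval (a + (s : ℂ) • b) p -
      eval (ζ s) L) =o[𝓝[>] 0] fun s : ℝ => (s : ℂ) ^ k := by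
    refine (hO.trans_isBigO (isBigO_of_le _ fun s => ?_)).congr_left fun s => ?_
    · simp [hζ]
    · simp only [Function.comp_apply, hζpt]
  refine (hpO.mul_isLittleO hO').congr' ?_ (by simp [pow_add])
  filter_upwards [hp0] with s hs
  have hLs : eval (a + (s : ℂ) • b) (bind₁ (fun i => 1 - C (a i)⁻¹ * X i) L) = eval (ζ s) L := by
    rw [← hζpt, ← coe_aeval_eq_eval, ← coe_aeval_eq_eval, RingHom.coe_coe, RingHom.coe_coe,
      aeval_bind₁]
    congr 2
    ext i
    simp [ha0 i]
  rw [map_sub, map_mul, hLs]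
  field_simp

end Bidisk

theorem mainTheorem10 (p : Bidisk.Poly) (hp : Bidisk.SemiStable p)
    (a : Fin 2 → ℂ) (ha : ∀ i, ‖a i‖ = 1) (M : ℕ) (hM : Bidisk.VanishesToOrder p a M) :
    M * (M + 1) ≤ Bidisk.intersectionMultiplicity a p (Bidisk.reflection p) ∧
    ∀ k : ℕ,
      Bidisk.NontangentiallyC k
        (fun z => MvPolynomial.eval z (Bidisk.reflection p) / MvPolynomial.eval z p) a →
      M * (M + k + 1) ≤ Bidisk.intersectionMultiplicity a p (Bidisk.reflection p) := by
  have ha0 : ∀ i, a i ≠ 0 := fun i h => by simpa [h] using ha i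
  constructor
  · obtain ⟨μ, hμ⟩ := Bidisk.exists_reflection_sub_isLittleO hp ha hM
    exact Bidisk.mul_le_intersectionMultiplicity_of_rays hp ha0 hM _ hμ
  · intro k hk
    obtain ⟨L, hL⟩ := Bidisk.isLittleO_of_nontangentiallyC hp ha hM hk
    exact Bidisk.mul_le_intersectionMultiplicity_of_rays hp ha0 hM _ hL
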